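/- A bivariate copula is a function $C\colon[0,1]^2\to[0,1]$ that is the restriction to $[0,1]^2$ of the distribution function of a probability measure on $[0,1]^2$ with uniform marginals; equivalently, $C(u,0)=C(0,v)=0$, $C(u,1)=u$, $C(1,v)=v$ for all $u,v\in[0,1]$, and $C(u_2,v_2)-C(u_2,v_1)-C(u_1,v_2)+C(u_1,v_1)\ge 0$ whenever $0\le u_1\le u_2\le 1$ and $0\le v_1\le v_2\le 1$. Let $\partial_2 C$ denote its partial derivative with respect to the second component; for each $u\in[0,1]$, $\partial_2C(u,t)$ exists for Lebesgue-almost every $t\in(0,1)$. Let $\Pi(u,v)=uv$, and define the upper product of copulas $D,E$ and the upper product transform by $$(D\vee E)(u,v)=\int_0^1\min\{\partial_2D(u,t),\partial_2E(v,t)\}\,dt,\qquad \mathcal T(C)=C\vee\Pi,\qquad \mathcal T^2=\mathcal T\circ\mathcal T .$$ Write $D\le_{lo}E$ if $D(u,v)\le E(u,v)$ for all $(u,v)\in[0,1]^2$. For a measurable $f\colon(0,1)\to[0,1]$, let $f^*$ be its decreasing rearrangement, i.e. the (essentially unique) decreasing function on $(0,1)$ with $\lambda(f^*\le y)=\lambda(f\le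 y)$ for all $y\in[0,1]$, where $\lambda$ is Lebesgue measure; explicitly $f^*(t)=\inf\{y\ge 0:\lambda(\{s\in(0,1): f(s)>y\})\le t\}$. Write $f\prec_S g$ if $\int_0^v f^*(t)\,dt\le\int_0^v g^*(t)\,dt$ for all $v\in(0,1)$, with equality for $v=1$. Write $D\le_{\partial_2S}E$ if $\partial_2D(v,\cdot)\prec_S\partial_2E(v,\cdot)$ for all $v\in(0,1)$. As usual, $\ge_{lo}$ and $\ge_{\partial_2S}$ denote the reversed relations. **Theorem.** Let $D$ and $E$ be bivariate copulas. Then the following statements are equivalent: 1. $D\le_{\partial_2S}E$; 2. $\mathcal T(D)\ge_{lo}\mathcal T(E)$; 3. $\mathcal T(D)\ge_{\partial_2S}\mathcal T(E)$; 4. $\mathcal T^2(D)\le_{lo}\mathcal T^2(E)$; 5. $\mathcal T^2(D)\le_{\partial_2S}\mathcal T^2(E)$. -/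

import Mathlib

open MeasureTheory

noncomputable section

/-- A bivariate copula: a distribution function on `[0,1]²` with standard uniform marginals, i.e. a
grounded and 2-increasing function with uniform margins. It is represented by a function on `ℝ²`,
of which only the values on the unit square are relevant. -/
structure IsCopula (C : ℝ → ℝ → ℝ) : Prop where
  zero_left : ∀ v ∈ Set.Icc (0 : ℝ) 1, C 0 v = 0
  zero_right : ∀ u ∈ Set.Icc (0 : ℝ) 1, C u 0 = 0
  one_left : ∀ v ∈ Set.Icc (0 : ℝ) 1, C 1 v = v
  one_right : ∀ u ∈ Set.Icc (0 : ℝ) 1, C u 1 = u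
  two_increasing : ∀ u₁ ∈ Set.Icc (0 : ℝ) 1, ∀ u₂ ∈ Set.Icc (0 : ℝ) 1,
    ∀ v₁ ∈ Set.Icc (0 : ℝ) 1, ∀ v₂ ∈ Set.Icc (0 : ℝ) 1, u₁ ≤ u₂ → v₁ ≤ v₂ →
      0 ≤ C u₂ v₂ - C u₂ v₁ - C u₁ v₂ + C u₁ v₁

/-- The derivative `∂₂C(u,t)` with respect to the second component. For a copula it exists for
almost every `t ∈ (0,1)`; at the exceptional points it is set to `0`. -/
def partialTwo (C : ℝ → ℝ → ℝ) (u t : ℝ) : ℝ := deriv (C u) t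

/-- The independence copula `Π(u,v) = uv`. -/
def indepCopula (u v : ℝ) : ℝ := u * v

/-- The upper product `(D ∨ E)(u,v) = ∫₀¹ min{∂₂D(u,t), ∂₂E(v,t)} dt`. -/
def upperProduct (D E : ℝ → ℝ → ℝ) (u v : ℝ) : ℝ :=
  ∫ t in (0 : ℝ)..1, min (partialTwo D u t) (partialTwo E v t)

/-- The upper product transform `T(C) = C ∨ Π`. -/
def upperTransform (C : ℝ → ℝ → ℝ) : ℝ → ℝ → ℝ := upperProduct C indepCopula

/-- The lower orthant order, i.e. the pointwise order on `[0,1]²`. -/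
def LowerOrthantLE (D E : ℝ → ℝ → ℝ) : Prop :=
  ∀ u ∈ Set.Icc (0 : ℝ) 1, ∀ v ∈ Set.Icc (0 : ℝ) 1, D u v ≤ E u v

/-- The decreasing rearrangement `f*(t) = inf {y ≥ 0 | λ{s ∈ (0,1) | f(s) > y} ≤ t}` of a
measurable function `f : (0,1) → [0,1]`. -/
def decRearrangement (f : ℝ → ℝ) (t : ℝ) : ℝ :=
  sInf {y : ℝ | 0 ≤ y ∧ volume.real {s ∈ Set.Ioo (0 : ℝ) 1 | y < f s} ≤ t}

/-- The Schur order `f ≺_S g` of measurable functions `(0,1) → [0,1]`. -/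
def SchurLE (f g : ℝ → ℝ) : Prop :=
  (∀ v ∈ Set.Ioo (0 : ℝ) 1,
    ∫ t in (0 : ℝ)..v, decRearrangement f t ≤ ∫ t in (0 : ℝ)..v, decRearrangement g t) ∧
  ∫ t in (0 : ℝ)..1, decRearrangement f t = ∫ t in (0 : ℝ)..1, decRearrangement g t

/-- The Schur order for copula derivatives with respect to the second component. -/
def DerivSchurLE (D E : ℝ → ℝ → ℝ) : Prop :=
  ∀ v ∈ Set.Ioo (0 : ℝ) 1, SchurLE (partialTwo D v) (partialTwo E v)

end

/-- The explicit formula does give the rearrangement: `f*` is decreasing on `(0,1)` and has the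
same distribution as `f`, which determines it almost everywhere. -/
theorem decRearrangement_spec (f : ℝ → ℝ) (hf : Measurable f)
    (hf1 : ∀ s ∈ Set.Ioo (0 : ℝ) 1, f s ∈ Set.Icc (0 : ℝ) 1) :
    AntitoneOn (decRearrangement f) (Set.Ioo 0 1) ∧
    ∀ y ∈ Set.Icc (0 : ℝ) 1, volume {t ∈ Set.Ioo (0 : ℝ) 1 | decRearrangement f t ≤ y} =
      volume {t ∈ Set.Ioo (0 : ℝ) 1 | f t ≤ y} := by
  have hfin : ∀ p : ℝ → Prop, volume {s ∈ Set.Ioo (0 : ℝ) 1 | p s} ≠ ⊤ := fun p =>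
    measure_ne_top_of_subset (Set.sep_subset _ _) (by simp)
  have hbdd : ∀ t : ℝ, BddBelow
      {y : ℝ | 0 ≤ y ∧ volume.real {s ∈ Set.Ioo (0 : ℝ) 1 | y < f s} ≤ t} :=
    fun t => ⟨0, fun y hy => hy.1⟩
  have hne : ∀ t : ℝ, 0 ≤ t →
      {y : ℝ | 0 ≤ y ∧ volume.real {s ∈ Set.Ioo (0 : ℝ) 1 | y < f s} ≤ t}.Nonempty := by
    intro t ht
    refine ⟨1, zero_le_one, ?_⟩
    have : {s ∈ Set.Ioo (0 : ℝ) 1 | 1 < f s} = ∅ := by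
      ext s
      simp only [Set.mem_ofPred_eq, Set.mem_empty_iff_false, iff_false, not_and, not_lt]
      exact fun hs => (hf1 s hs).2
    rw [this]
    simpa using ht
  have key : ∀ t : ℝ, 0 ≤ t → ∀ y : ℝ, 0 ≤ y → (decRearrangement f t ≤ y ↔
      volume.real {s ∈ Set.Ioo (0 : ℝ) 1 | y < f s} ≤ t) := by
    intro t ht y hy
    refine ⟨fun h => ?_, fun h => csInf_le (hbdd t) ⟨hy, h⟩⟩
    have hU : {s ∈ Set.Ioo (0 : ℝ) 1 | y < f s} =
        ⋃ n : ℕ, {s ∈ Set.Ioo (0 : ℝ) 1 | y + 1 / ((n : ℝ) + 1) < f s} := by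
      ext s
      simp only [Set.mem_ofPred_eq, Set.mem_iUnion]
      constructor
      · rintro ⟨hs, h1⟩
        obtain ⟨n, hn⟩ := exists_nat_one_div_lt (sub_pos.mpr h1)
        exact ⟨n, hs, by linarith⟩
      · rintro ⟨n, hs, h1⟩
        have : (0 : ℝ) < 1 / ((n : ℝ) + 1) := by positivity
        exact ⟨hs, by linarith⟩
    have hmono : Monotone
        (fun n : ℕ => {s ∈ Set.Ioo (0 : ℝ) 1 | y + 1 / ((n : ℝ) + 1) < f s}) := by
      intro m n hmn s hs
      refine ⟨hs.1, lt_of_le_of_lt ?_ hs.2⟩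
      have := Nat.one_div_le_one_div (α := ℝ) hmn
      linarith
    rw [measureReal_def, hU, hmono.measure_iUnion]
    refine ENNReal.toReal_le_of_le_ofReal ht (iSup_le fun n => ?_)
    rw [ENNReal.le_ofReal_iff_toReal_le (hfin _) ht]
    have hpos : (0 : ℝ) < 1 / ((n : ℝ) + 1) := by positivity
    obtain ⟨z, hz, hzy⟩ := exists_lt_of_csInf_lt (hne t ht)
      (lt_of_le_of_lt h (lt_add_of_pos_right y hpos))
    refine le_trans (measureReal_mono ?_ (hfin _)) hz.2
    exact fun s hs => ⟨hs.1, hzy.trans hs.2⟩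
  refine ⟨?_, ?_⟩
  · intro a ha b _ hab
    exact csInf_le_csInf (hbdd b) (hne a ha.1.le) fun y hy => ⟨hy.1, hy.2.trans hab⟩
  · intro y hy
    set m := volume.real {s ∈ Set.Ioo (0 : ℝ) 1 | y < f s} with hm
    have h0 : 0 ≤ m := measureReal_nonneg
    have hset : {t ∈ Set.Ioo (0 : ℝ) 1 | f t ≤ y} =
        Set.Ioo (0 : ℝ) 1 \ {s ∈ Set.Ioo (0 : ℝ) 1 | y < f s} := by
      ext s
      simp only [Set.mem_ofPred_eq, Set.mem_sdiff, not_and, not_lt]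
      exact ⟨fun h => ⟨h.1, fun _ => h.2⟩, fun h => ⟨h.1, h.2 h.1⟩⟩
    have hmeas : MeasurableSet {s ∈ Set.Ioo (0 : ℝ) 1 | y < f s} :=
      measurableSet_Ioo.inter (measurableSet_lt measurable_const hf)
    have hR : volume {t ∈ Set.Ioo (0 : ℝ) 1 | f t ≤ y} = ENNReal.ofReal (1 - m) := by
      rw [hset, measure_sdiff (Set.sep_subset _ _) hmeas.nullMeasurableSet (hfin _),
        Real.volume_Ioo, sub_zero, ENNReal.ofReal_sub _ h0, hm, measureReal_def,
        ENNReal.ofReal_toReal (hfin _)]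
    rw [hR]
    refine le_antisymm ?_ ?_
    · rw [← Real.volume_Icc]
      refine measure_mono fun t ht => ⟨(key t ht.1.1.le y hy.1).1 ht.2, ht.1.2.le⟩
    · rw [← Real.volume_Ioo]
      refine measure_mono fun t ht => ?_
      have ht0 : 0 < t := lt_of_le_of_lt h0 ht.1
      exact ⟨⟨ht0, ht.2⟩, (key t ht0.le y hy.1).2 ht.1.le⟩

open Set

/-! Since `∂₂Π(v, ·) = v`, the layer cake formula gives `T(C)(u,v) = ∫₀¹ min(∂₂C(u,t), v) dt = ∫₀ᵛ
λ{∂₂C(u, ·) > y} dy`. Two facts follow. (a) For functions of equal integral, majorization is dual to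
the reversed comparison of all truncated integrals `∫ min(·, v)`. Hence `≤_{∂₂S}` between `D` and
`E` is the reversed pointwise order between the transforms (`derivSchurLE_iff_lowerOrthantLE`). (b)
`∂₂T(C)(u, ·)` is a.e. a survival function, thus decreasing and its own rearrangement. Integrating
it returns `T(C)`, so on transforms `≤_{∂₂S}` is the pointwise order
(`derivSchurLE_upperTransform_iff`). Alternating (a) and (b) along `D`, `T(D)`, `T²(D)` yields all
equivalences. Only the sections `C(u, ·)` matter, so the class preserved by `T` is
`HasCopulaSections`; that `T(C)` is a copula is not needed. -/

/-! ### Unit functions and the layer cake formula. -/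

/-- A measurable-up-to-null-sets function on `(0,1)` with values in `[0,1]`. -/
structure IsUnitFunction (f : ℝ → ℝ) : Prop where
  aemeasurable : AEMeasurable f (volume.restrict (Ioo (0 : ℝ) 1))
  mem_Icc : ∀ s ∈ Ioo (0 : ℝ) 1, f s ∈ Icc (0 : ℝ) 1

/-- The survival function `y ↦ λ {s ∈ (0,1) | y < f s}`. -/
noncomputable def survival (f : ℝ → ℝ) (y : ℝ) : ℝ :=
  volume.real {s ∈ Ioo (0 : ℝ) 1 | y < f s}

theorem measure_sep_unit_ne_top (p : ℝ → Prop) : volume {s ∈ Ioo (0 : ℝ) 1 | p s} ≠ ⊤ :=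
  measure_ne_top_of_subset (sep_subset _ _) (by simp)

theorem survival_antitone (f : ℝ → ℝ) : Antitone (survival f) := fun _ _ h =>
  measureReal_mono (fun _ hs => ⟨hs.1, h.trans_lt hs.2⟩) (measure_sep_unit_ne_top _)

theorem survival_mem_Icc (f : ℝ → ℝ) (y : ℝ) : survival f y ∈ Icc (0 : ℝ) 1 := by
  refine ⟨measureReal_nonneg, ?_⟩
  refine (measureReal_mono (s₂ := Ioo (0 : ℝ) 1) (sep_subset _ _) (by simp)).trans ?_
  simp

theorem survival_congr_ae {f g : ℝ → ℝ} (h : f =ᵐ[volume.restrict (Ioo (0 : ℝ) 1)] g) :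
    survival f = survival g := by
  ext y
  refine congrArg ENNReal.toReal (measure_congr ?_)
  rw [Filter.EventuallyEq, ae_restrict_iff' measurableSet_Ioo] at h
  filter_upwards [h] with s hs
  refine propext ⟨fun h' => ⟨h'.1, ?_⟩, fun h' => ⟨h'.1, ?_⟩⟩
  · rw [← hs h'.1]; exact h'.2
  · rw [hs h'.1]; exact h'.2

theorem decRearrangement_congr_ae {f g : ℝ → ℝ}
    (h : f =ᵐ[volume.restrict (Ioo (0 : ℝ) 1)] g) : decRearrangement f = decRearrangement g := by
  have := survival_congr_ae h
  ext t
  exact congrArg sInf (Set.ext fun y => by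
    change 0 ≤ y ∧ survival f y ≤ t ↔ 0 ≤ y ∧ survival g y ≤ t
    rw [this])

namespace IsUnitFunction

variable {f : ℝ → ℝ}

theorem integrableOn (hf : IsUnitFunction f) : IntegrableOn f (Ioo 0 1) := by
  refine Integrable.of_bound hf.aemeasurable.aestronglyMeasurable 1 ?_
  filter_upwards [ae_restrict_mem measurableSet_Ioo] with s hs
  rw [Real.norm_of_nonneg (hf.mem_Icc s hs).1]
  exact (hf.mem_Icc s hs).2

theorem intervalIntegrable (hf : IsUnitFunction f) {a b : ℝ} (ha : a ∈ Icc (0 : ℝ) 1)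
    (hb : b ∈ Icc (0 : ℝ) 1) : IntervalIntegrable f volume a b := by
  have h : IntervalIntegrable f volume 0 1 := by
    rw [intervalIntegrable_iff_integrableOn_Ioo_of_le zero_le_one]
    exact hf.integrableOn
  exact h.mono_set (uIcc_subset_uIcc (by simpa using ha) (by simpa using hb))

theorem min_const (hf : IsUnitFunction f) {v : ℝ} (hv : v ∈ Icc (0 : ℝ) 1) :
    IsUnitFunction fun t => min (f t) v :=
  ⟨hf.aemeasurable.min aemeasurable_const, fun s hs =>
    ⟨le_min (hf.mem_Icc s hs).1 hv.1, (min_le_right _ _).trans hv.2⟩⟩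

/-- Layer cake: `{min f v > y}` is `{f > y}` for `y < v` and empty for `y ≥ v`. -/
theorem integral_min_eq (hf : IsUnitFunction f) {v : ℝ} (hv : v ∈ Icc (0 : ℝ) 1) :
    ∫ t in (0 : ℝ)..1, min (f t) v = ∫ y in (0 : ℝ)..v, survival f y := by
  have hmin := hf.min_const hv
  rw [intervalIntegral.integral_of_le zero_le_one, integral_Ioc_eq_integral_Ioo,
    Integrable.integral_eq_integral_meas_lt hmin.integrableOn
      ((ae_restrict_mem measurableSet_Ioo).mono fun s hs => (hmin.mem_Icc s hs).1),
    intervalIntegral.integral_of_le hv.1, integral_Ioc_eq_integral_Ioo]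
  rw [← integral_indicator measurableSet_Ioi, ← integral_indicator measurableSet_Ioo]
  congr 1
  ext y
  by_cases hy : y ∈ Ioo 0 v
  · rw [indicator_of_mem hy, indicator_of_mem (show y ∈ Ioi 0 from hy.1), measureReal_def,
      Measure.restrict_apply' measurableSet_Ioo, survival, measureReal_def]
    congr 2
    ext s
    simp only [mem_inter_iff, mem_ofPred_eq, lt_min_iff]
    exact ⟨fun h => ⟨h.2, h.1.1⟩, fun h => ⟨⟨h.2, hy.2⟩, h.1⟩⟩
  · rw [indicator_of_notMem hy]
    by_cases hy0 : y ∈ Ioi (0 : ℝ)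
    · have hvy : v ≤ y := not_lt.1 fun h => hy ⟨hy0, h⟩
      rw [indicator_of_mem hy0]
      have : {a | y < min (f a) v} = ∅ := by
        ext s
        simp only [mem_ofPred_eq, lt_min_iff, mem_empty_iff_false, iff_false]
        exact fun h => absurd h.2 (not_lt.2 hvy)
      rw [this, measureReal_empty]
    · rw [indicator_of_notMem hy0]

theorem integral_min_one (hf : IsUnitFunction f) :
    ∫ t in (0 : ℝ)..1, min (f t) 1 = ∫ t in (0 : ℝ)..1, f t := by
  rw [intervalIntegral.integral_of_le zero_le_one, intervalIntegral.integral_of_le zero_le_one,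
    integral_Ioc_eq_integral_Ioo, integral_Ioc_eq_integral_Ioo]
  exact setIntegral_congr_fun measurableSet_Ioo fun s hs => min_eq_left (hf.mem_Icc s hs).2

theorem decRearrangement_mem_Icc (hf : IsUnitFunction f) {t : ℝ} (ht : 0 ≤ t) :
    decRearrangement f t ∈ Icc (0 : ℝ) 1 := by
  refine ⟨Real.sInf_nonneg fun y hy => hy.1, csInf_le ⟨0, fun y hy => hy.1⟩ ⟨zero_le_one, ?_⟩⟩
  have : {s ∈ Ioo (0 : ℝ) 1 | 1 < f s} = ∅ := by
    ext s
    simp only [mem_ofPred_eq, mem_empty_iff_false, iff_false, not_and, not_lt]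
    exact fun hs => (hf.mem_Icc s hs).2
  rw [this]
  simpa using ht

end IsUnitFunction

/-! ### Rearrangement preserves truncated integrals. -/

/-- An `IsUnitFunction` which is decreasing on `(0,1)`. -/
structure IsDecUnitFunction (f : ℝ → ℝ) : Prop extends IsUnitFunction f where
  antitoneOn : AntitoneOn f (Ioo 0 1)

theorem isDecUnitFunction_decRearrangement {f : ℝ → ℝ} (hf : IsUnitFunction f)
    (hm : Measurable f) : IsDecUnitFunction (decRearrangement f) := by
  have h := (decRearrangement_spec f hm hf.mem_Icc).1
  exact ⟨⟨aemeasurable_restrict_of_antitoneOn measurableSet_Ioo h,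
    fun s hs => hf.decRearrangement_mem_Icc hs.1.le⟩, h⟩

theorem survival_eq_one_sub {f : ℝ → ℝ} (hf : AEMeasurable f (volume.restrict (Ioo (0 : ℝ) 1)))
    (y : ℝ) : survival f y = 1 - volume.real {s ∈ Ioo (0 : ℝ) 1 | f s ≤ y} := by
  have hn : NullMeasurableSet {s | f s ≤ y} (volume.restrict (Ioo (0 : ℝ) 1)) :=
    nullMeasurableSet_le hf aemeasurable_const
  have h := measureReal_compl₀ hn
  rw [measureReal_restrict_apply' measurableSet_Ioo, measureReal_restrict_apply' measurableSet_Ioo,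
    measureReal_restrict_apply' measurableSet_Ioo, univ_inter, Real.volume_real_Ioo_of_le
    zero_le_one, sub_zero] at h
  have hl : {s | f s ≤ y}ᶜ ∩ Ioo 0 1 = {s ∈ Ioo (0 : ℝ) 1 | y < f s} := by
    ext s
    simp [and_comm]
  have hr : {s | f s ≤ y} ∩ Ioo 0 1 = {s ∈ Ioo (0 : ℝ) 1 | f s ≤ y} := by
    ext s
    simp [and_comm]
  rwa [hl, hr] at h

theorem survival_decRearrangement {f : ℝ → ℝ} (hf : IsUnitFunction f) (hm : Measurable f)
    {y : ℝ} (hy : y ∈ Icc (0 : ℝ) 1) : survival (decRearrangement f) y = survival f y := by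
  rw [survival_eq_one_sub hf.aemeasurable,
    survival_eq_one_sub (isDecUnitFunction_decRearrangement hf hm).aemeasurable,
    measureReal_def, measureReal_def, (decRearrangement_spec f hm hf.mem_Icc).2 y hy]

theorem integral_min_decRearrangement {f : ℝ → ℝ} (hf : IsUnitFunction f) (hm : Measurable f)
    {v : ℝ} (hv : v ∈ Icc (0 : ℝ) 1) :
    ∫ t in (0 : ℝ)..1, min (decRearrangement f t) v = ∫ t in (0 : ℝ)..1, min (f t) v := by
  rw [hf.integral_min_eq hv,
    (isDecUnitFunction_decRearrangement hf hm).toIsUnitFunction.integral_min_eq hv]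
  refine intervalIntegral.integral_congr fun y hy => ?_
  rw [uIcc_of_le hv.1] at hy
  exact survival_decRearrangement hf hm ⟨hy.1, hy.2.trans hv.2⟩

theorem integral_decRearrangement {f : ℝ → ℝ} (hf : IsUnitFunction f) (hm : Measurable f) :
    ∫ t in (0 : ℝ)..1, decRearrangement f t = ∫ t in (0 : ℝ)..1, f t := by
  rw [← hf.integral_min_one,
    ← (isDecUnitFunction_decRearrangement hf hm).toIsUnitFunction.integral_min_one]
  exact integral_min_decRearrangement hf hm ⟨zero_le_one, le_rfl⟩

/-! ### Duality between majorization and truncation. -/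

theorem IsUnitFunction.integral_min_le {f : ℝ → ℝ} (hf : IsUnitFunction f) {s v : ℝ}
    (hs : s ∈ Icc (0 : ℝ) 1) (hv : v ∈ Icc (0 : ℝ) 1) :
    ∫ t in (0 : ℝ)..1, min (f t) v ≤ v * s + ∫ t in s..1, f t := by
  have h0 : (0 : ℝ) ∈ Icc (0 : ℝ) 1 := ⟨le_rfl, zero_le_one⟩
  have h1 : (1 : ℝ) ∈ Icc (0 : ℝ) 1 := ⟨zero_le_one, le_rfl⟩
  have hm := hf.min_const hv
  rw [← intervalIntegral.integral_add_adjacent_intervals (hm.intervalIntegrable h0 hs)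
    (hm.intervalIntegrable hs h1)]
  refine add_le_add ?_ ?_
  · calc ∫ t in (0 : ℝ)..s, min (f t) v ≤ ∫ _ in (0 : ℝ)..s, v :=
          intervalIntegral.integral_mono_on_of_le_Ioo hs.1 (hm.intervalIntegrable h0 hs)
            intervalIntegrable_const fun t _ => min_le_right _ _
      _ = v * s := by simp [mul_comm]
  · exact intervalIntegral.integral_mono_on_of_le_Ioo hs.2 (hm.intervalIntegrable hs h1)
      (hf.intervalIntegrable hs h1) fun t _ => min_le_left _ _

/-- The bound of `integral_min_le` is attained when `f` crosses the level `v` at `s`. -/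
theorem IsUnitFunction.le_integral_min {f : ℝ → ℝ} (hf : IsUnitFunction f) {s v : ℝ}
    (hs : s ∈ Icc (0 : ℝ) 1) (hv : v ∈ Icc (0 : ℝ) 1) (hl : ∀ t ∈ Ioo 0 s, v ≤ f t)
    (hr : ∀ t ∈ Ioo s 1, f t ≤ v) :
    v * s + ∫ t in s..1, f t ≤ ∫ t in (0 : ℝ)..1, min (f t) v := by
  have h0 : (0 : ℝ) ∈ Icc (0 : ℝ) 1 := ⟨le_rfl, zero_le_one⟩
  have h1 : (1 : ℝ) ∈ Icc (0 : ℝ) 1 := ⟨zero_le_one, le_rfl⟩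
  have hm := hf.min_const hv
  rw [← intervalIntegral.integral_add_adjacent_intervals (hm.intervalIntegrable h0 hs)
    (hm.intervalIntegrable hs h1)]
  refine add_le_add ?_ ?_
  · calc v * s = ∫ _ in (0 : ℝ)..s, v := by simp [mul_comm]
      _ ≤ ∫ t in (0 : ℝ)..s, min (f t) v :=
          intervalIntegral.integral_mono_on_of_le_Ioo hs.1 intervalIntegrable_const
            (hm.intervalIntegrable h0 hs) fun t ht => le_min (hl t ht) le_rfl
  · exact intervalIntegral.integral_mono_on_of_le_Ioo hs.2 (hf.intervalIntegrable hs h1)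
      (hm.intervalIntegrable hs h1) fun t ht => le_min le_rfl (hr t ht)

theorem IsDecUnitFunction.exists_threshold {f : ℝ → ℝ} (hf : IsDecUnitFunction f) (v : ℝ) :
    ∃ s ∈ Icc (0 : ℝ) 1, (∀ t ∈ Ioo 0 s, v ≤ f t) ∧ ∀ t ∈ Ioo s 1, f t ≤ v := by
  -- Inserting `0` keeps the set nonempty when `f ≤ v` throughout, giving `s = 0`.
  have hbdd : BddAbove (insert 0 {t ∈ Ioo (0 : ℝ) 1 | v < f t}) := by
    refine ⟨1, ?_⟩
    rintro t (rfl | ht)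
    exacts [zero_le_one, ht.1.2.le]
  have h0 : 0 ≤ sSup (insert 0 {t ∈ Ioo (0 : ℝ) 1 | v < f t}) :=
    le_csSup hbdd (mem_insert _ _)
  refine ⟨_, ⟨h0, csSup_le (insert_nonempty _ _) ?_⟩, fun t ht => ?_, fun t ht => ?_⟩
  · rintro t (rfl | ht)
    exacts [zero_le_one, ht.1.2.le]
  · obtain ⟨r, hr | hr, htr⟩ := exists_lt_of_lt_csSup (insert_nonempty _ _) ht.2
    · exact absurd ht.1 (not_lt.2 (hr ▸ htr.le))
    · exact hr.2.le.trans (hf.antitoneOn ⟨ht.1, htr.trans hr.1.2⟩ hr.1 htr.le)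
  · by_contra! h
    exact absurd (le_csSup hbdd (mem_insert_of_mem _ ⟨⟨h0.trans_lt ht.1, ht.2⟩, h⟩))
      (not_le.2 ht.1)

/-- Majorization of decreasing functions is dual to the pointwise comparison of the truncated
integrals. -/
theorem IsDecUnitFunction.forall_integral_le_iff {p q : ℝ → ℝ} (hp : IsDecUnitFunction p)
    (hq : IsDecUnitFunction q) (h : ∫ t in (0 : ℝ)..1, p t = ∫ t in (0 : ℝ)..1, q t) :
    (∀ s ∈ Ioo (0 : ℝ) 1, ∫ t in (0 : ℝ)..s, p t ≤ ∫ t in (0 : ℝ)..s, q t) ↔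
      ∀ v ∈ Icc (0 : ℝ) 1,
        ∫ t in (0 : ℝ)..1, min (q t) v ≤ ∫ t in (0 : ℝ)..1, min (p t) v := by
  have h0 : (0 : ℝ) ∈ Icc (0 : ℝ) 1 := ⟨le_rfl, zero_le_one⟩
  have h1 : (1 : ℝ) ∈ Icc (0 : ℝ) 1 := ⟨zero_le_one, le_rfl⟩
  have hsplit : ∀ {f : ℝ → ℝ}, IsDecUnitFunction f → ∀ s ∈ Icc (0 : ℝ) 1,
      (∫ t in (0 : ℝ)..s, f t) + ∫ t in s..1, f t = ∫ t in (0 : ℝ)..1, f t := fun hf s hs =>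
    intervalIntegral.integral_add_adjacent_intervals
      (hf.toIsUnitFunction.intervalIntegrable h0 hs)
      (hf.toIsUnitFunction.intervalIntegrable hs h1)
  constructor
  · intro H v hv
    -- Split where `p` crosses `v`: the tail bound is sharp for `p` and an upper bound for `q`.
    obtain ⟨s, hs, hl, hr⟩ := hp.exists_threshold v
    have a := hp.toIsUnitFunction.le_integral_min hs hv hl hr
    have b := hq.toIsUnitFunction.integral_min_le hs hv
    have c := hsplit hp s hs
    have d := hsplit hq s hs
    have e : ∫ t in (0 : ℝ)..s, p t ≤ ∫ t in (0 : ℝ)..s, q t := by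
      rcases hs.1.eq_or_lt with rfl | hs0
      · simp
      rcases hs.2.eq_or_lt with rfl | hs1
      · exact h.le
      exact H s ⟨hs0, hs1⟩
    linarith
  · intro H s hs
    have hs' : s ∈ Icc (0 : ℝ) 1 := ⟨hs.1.le, hs.2.le⟩
    -- Conversely truncate at `v = q s`, which makes the bound sharp for `q`.
    have hv := hq.mem_Icc s hs
    have a := hq.toIsUnitFunction.le_integral_min hs' hv
      (fun t ht => hq.antitoneOn ⟨ht.1, ht.2.trans hs.2⟩ hs ht.2.le)
      (fun t ht => hq.antitoneOn hs ⟨hs.1.trans ht.1, ht.2⟩ ht.1.le)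
    have b := hp.toIsUnitFunction.integral_min_le hs' hv
    have c := hsplit hp s hs'
    have d := hsplit hq s hs'
    have e := H _ hv
    linarith

theorem schurLE_iff {f g : ℝ → ℝ} (hf : IsUnitFunction f) (hfm : Measurable f)
    (hg : IsUnitFunction g) (hgm : Measurable g)
    (h : ∫ t in (0 : ℝ)..1, f t = ∫ t in (0 : ℝ)..1, g t) :
    SchurLE f g ↔ ∀ v ∈ Icc (0 : ℝ) 1,
      ∫ t in (0 : ℝ)..1, min (g t) v ≤ ∫ t in (0 : ℝ)..1, min (f t) v := by
  have h' : ∫ t in (0 : ℝ)..1, decRearrangement f t = ∫ t in (0 : ℝ)..1, decRearrangement g t := by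
    rw [integral_decRearrangement hf hfm, integral_decRearrangement hg hgm, h]
  rw [SchurLE, and_iff_left h', (isDecUnitFunction_decRearrangement hf hfm).forall_integral_le_iff
    (isDecUnitFunction_decRearrangement hg hgm) h']
  refine forall₂_congr fun v hv => ?_
  rw [integral_min_decRearrangement hf hfm hv, integral_min_decRearrangement hg hgm hv]

/-! ### Decreasing functions are their own rearrangement. -/

theorem decRearrangement_eq_of_continuousAt {k : ℝ → ℝ} (hk : Antitone k)
    (hk0 : ∀ y, 0 ≤ k y) {t : ℝ} (ht : t ∈ Ioo (0 : ℝ) 1) (hc : ContinuousAt k t) :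
    decRearrangement k t = k t := by
  have hmem : k t ∈ {y : ℝ | 0 ≤ y ∧ volume.real {s ∈ Ioo (0 : ℝ) 1 | y < k s} ≤ t} := by
    refine ⟨hk0 t, ?_⟩
    calc volume.real {s ∈ Ioo (0 : ℝ) 1 | k t < k s} ≤ volume.real (Ioo 0 t) :=
          measureReal_mono (fun s hs => ⟨hs.1.1, hk.reflect_lt hs.2⟩) (by simp)
      _ = t := by simp [ht.1.le]
  refine le_antisymm (csInf_le ⟨0, fun y hy => hy.1⟩ hmem) (le_csInf ⟨_, hmem⟩ fun y hy => ?_)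
  by_contra! hlt
  -- By continuity a level `y < k t` is still exceeded beyond `t`, so its superlevel set has measure
  -- greater than `t`.
  obtain ⟨r, hr, hyr⟩ : ∃ r ∈ Ioo t 1, y < k r := by
    have h1 : ∀ᶠ r in nhdsWithin t (Ioi t), y < k r :=
      (hc.eventually_const_lt hlt).filter_mono nhdsWithin_le_nhds
    have h2 : ∀ᶠ r in nhdsWithin t (Ioi t), r ∈ Ioo t 1 := Ioo_mem_nhdsGT ht.2
    exact (h2.and h1).exists
  have : r ≤ volume.real {s ∈ Ioo (0 : ℝ) 1 | y < k s} := by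
    calc r = volume.real (Ioo 0 r) := by simp [(ht.1.trans hr.1).le]
      _ ≤ volume.real {s ∈ Ioo (0 : ℝ) 1 | y < k s} := measureReal_mono
          (fun s hs => ⟨⟨hs.1, hs.2.trans hr.2⟩, hyr.trans_le (hk hs.2.le)⟩)
          (measure_sep_unit_ne_top _)
  linarith [hy.2, hr.1]

theorem integral_decRearrangement_of_antitone {k : ℝ → ℝ} (hk : Antitone k)
    (hk0 : ∀ y, 0 ≤ k y) {v : ℝ} (hv : v ∈ Icc (0 : ℝ) 1) :
    ∫ t in (0 : ℝ)..v, decRearrangement k t = ∫ t in (0 : ℝ)..v, k t := by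
  rw [intervalIntegral.integral_of_le hv.1, intervalIntegral.integral_of_le hv.1,
    integral_Ioc_eq_integral_Ioo, integral_Ioc_eq_integral_Ioo]
  refine setIntegral_congr_ae measurableSet_Ioo ?_
  filter_upwards [hk.countable_not_continuousAt.ae_notMem volume] with t ht htv
  exact decRearrangement_eq_of_continuousAt hk hk0 ⟨htv.1, htv.2.trans_le hv.2⟩ (not_not.1 ht)

/-! ### Copula sections and the transform. -/

/-- The sections `C(u, ·)` run from `0` to `u` and are increasing and `1`-Lipschitz. -/
structure HasCopulaSections (C : ℝ → ℝ → ℝ) : Prop where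
  zero_right : ∀ u ∈ Icc (0 : ℝ) 1, C u 0 = 0
  one_right : ∀ u ∈ Icc (0 : ℝ) 1, C u 1 = u
  mono : ∀ u ∈ Icc (0 : ℝ) 1, MonotoneOn (C u) (Icc 0 1)
  lipschitz : ∀ u ∈ Icc (0 : ℝ) 1, LipschitzOnWith 1 (C u) (Icc 0 1)

theorem MonotoneOn.lipschitzOnWith_one {f : ℝ → ℝ} {S : Set ℝ} (hf : MonotoneOn f S)
    (h : ∀ s ∈ S, ∀ t ∈ S, s ≤ t → f t - f s ≤ t - s) : LipschitzOnWith 1 f S := by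
  refine LipschitzOnWith.of_dist_le_mul fun s hs t ht => ?_
  rw [NNReal.coe_one, one_mul, Real.dist_eq, Real.dist_eq]
  rcases le_total s t with hst | hst
  · rw [abs_sub_comm, abs_sub_comm s, abs_of_nonneg (sub_nonneg.2 (hf hs ht hst)),
      abs_of_nonneg (sub_nonneg.2 hst)]
    exact h s hs t ht hst
  · rw [abs_of_nonneg (sub_nonneg.2 (hf ht hs hst)), abs_of_nonneg (sub_nonneg.2 hst)]
    exact h t ht s hs hst

/-- Rectangles reaching down to `u = 0` give monotonicity, those reaching up to `u = 1` the
Lipschitz bound. -/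
theorem IsCopula.hasCopulaSections {C : ℝ → ℝ → ℝ} (hC : IsCopula C) : HasCopulaSections C := by
  have h0 : (0 : ℝ) ∈ Icc (0 : ℝ) 1 := ⟨le_rfl, zero_le_one⟩
  have h1 : (1 : ℝ) ∈ Icc (0 : ℝ) 1 := ⟨zero_le_one, le_rfl⟩
  have hmono : ∀ u ∈ Icc (0 : ℝ) 1, MonotoneOn (C u) (Icc 0 1) := by
    intro u hu s hs t ht hst
    have := hC.two_increasing 0 h0 u hu s hs t ht hu.1 hst
    rw [hC.zero_left s hs, hC.zero_left t ht] at this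
    linarith
  refine ⟨hC.zero_right, hC.one_right, hmono, fun u hu =>
    (hmono u hu).lipschitzOnWith_one fun s hs t ht hst => ?_⟩
  have := hC.two_increasing u hu 1 h1 s hs t ht hu.2 hst
  rw [hC.one_left s hs, hC.one_left t ht] at this
  linarith

theorem partialTwo_indepCopula (v t : ℝ) : partialTwo indepCopula v t = v := by
  have : indepCopula v = fun t => v * t := rfl
  simp [partialTwo, this]

theorem upperTransform_apply (C : ℝ → ℝ → ℝ) (u v : ℝ) :
    upperTransform C u v = ∫ t in (0 : ℝ)..1, min (partialTwo C u t) v := by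
  simp only [upperTransform, upperProduct, partialTwo_indepCopula]

namespace HasCopulaSections

variable {C D E : ℝ → ℝ → ℝ}

theorem measurable_partialTwo (C : ℝ → ℝ → ℝ) (u : ℝ) : Measurable (partialTwo C u) :=
  measurable_deriv (C u)

theorem isUnitFunction_partialTwo (hC : HasCopulaSections C) {u : ℝ} (hu : u ∈ Icc (0 : ℝ) 1) :
    IsUnitFunction (partialTwo C u) := by
  -- Both bounds survive at points of non-differentiability, where `deriv` is `0`.
  refine ⟨(measurable_partialTwo C u).aemeasurable, fun t ht => ⟨?_, ?_⟩⟩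
  · have hn : Icc (0 : ℝ) 1 ∈ nhds t := Icc_mem_nhds ht.1 ht.2
    rw [partialTwo, ← derivWithin_of_mem_nhds hn]
    exact (hC.mono u hu).derivWithin_nonneg
  · refine (Real.le_norm_self _).trans (norm_deriv_le_of_lip' zero_le_one ?_)
    filter_upwards [Icc_mem_nhds ht.1 ht.2] with s hs
    simpa [Real.dist_eq] using (hC.lipschitz u hu).dist_le_mul s hs t ⟨ht.1.le, ht.2.le⟩

/-- Lipschitz sections are absolutely continuous. The total mass `u` is the same for every `C`, as
the duality requires. -/
theorem integral_partialTwo (hC : HasCopulaSections C) {u : ℝ} (hu : u ∈ Icc (0 : ℝ) 1) :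
    ∫ t in (0 : ℝ)..1, partialTwo C u t = u := by
  have h : AbsolutelyContinuousOnInterval (C u) 0 1 :=
    LipschitzOnWith.absolutelyContinuousOnInterval
      (by rw [uIcc_of_le zero_le_one]; exact hC.lipschitz u hu)
  have := h.integral_deriv_eq_sub
  rw [hC.one_right u hu, hC.zero_right u hu, sub_zero] at this
  exact this

theorem upperTransform_eq_integral_survival (hC : HasCopulaSections C) {u v : ℝ}
    (hu : u ∈ Icc (0 : ℝ) 1) (hv : v ∈ Icc (0 : ℝ) 1) :
    upperTransform C u v = ∫ y in (0 : ℝ)..v, survival (partialTwo C u) y := by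
  rw [upperTransform_apply, (hC.isUnitFunction_partialTwo hu).integral_min_eq hv]

theorem upperTransform (hC : HasCopulaSections C) : HasCopulaSections (upperTransform C) := by
  have hsub : ∀ u ∈ Icc (0 : ℝ) 1, ∀ s ∈ Icc (0 : ℝ) 1, ∀ t ∈ Icc (0 : ℝ) 1,
      _root_.upperTransform C u t - _root_.upperTransform C u s =
        ∫ y in s..t, survival (partialTwo C u) y := by
    intro u hu s hs t ht
    rw [hC.upperTransform_eq_integral_survival hu hs, hC.upperTransform_eq_integral_survival hu ht]
    exact intervalIntegral.integral_interval_sub_left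
      (survival_antitone _).intervalIntegrable (survival_antitone _).intervalIntegrable
  have hmono : ∀ u ∈ Icc (0 : ℝ) 1, MonotoneOn (_root_.upperTransform C u) (Icc 0 1) := by
    intro u hu s hs t ht hst
    rw [← sub_nonneg, hsub u hu s hs t ht]
    exact intervalIntegral.integral_nonneg hst fun y _ => (survival_mem_Icc _ y).1
  refine ⟨fun u hu => ?_, fun u hu => ?_, hmono, fun u hu =>
    (hmono u hu).lipschitzOnWith_one fun s hs t ht hst => ?_⟩
  · rw [hC.upperTransform_eq_integral_survival hu ⟨le_rfl, zero_le_one⟩]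
    simp
  · rw [upperTransform_apply, (hC.isUnitFunction_partialTwo hu).integral_min_one,
      hC.integral_partialTwo hu]
  · rw [hsub u hu s hs t ht]
    calc ∫ y in s..t, survival (partialTwo C u) y ≤ ∫ _ in s..t, (1 : ℝ) :=
          intervalIntegral.integral_mono_on hst (survival_antitone _).intervalIntegrable
            intervalIntegrable_const fun y _ => (survival_mem_Icc _ y).2
      _ = t - s := by simp

/-- A survival function is monotone, so it is continuous off a countable set, where its primitive
can be differentiated. -/
theorem partialTwo_upperTransform_ae (hC : HasCopulaSections C) {u : ℝ}
    (hu : u ∈ Icc (0 : ℝ) 1) :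
    partialTwo (_root_.upperTransform C) u =ᵐ[volume.restrict (Ioo (0 : ℝ) 1)]
      survival (partialTwo C u) := by
  rw [Filter.EventuallyEq, ae_restrict_iff' measurableSet_Ioo]
  have hk := survival_antitone (partialTwo C u)
  filter_upwards [hk.countable_not_continuousAt.ae_notMem volume] with t ht ht01
  have hd := intervalIntegral.integral_hasDerivAt_right (a := 0) (b := t) hk.intervalIntegrable
    hk.measurable.stronglyMeasurable.stronglyMeasurableAtFilter (not_not.1 ht)
  have he : _root_.upperTransform C u =ᶠ[nhds t]
      fun v => ∫ y in (0 : ℝ)..v, survival (partialTwo C u) y := by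
    filter_upwards [Icc_mem_nhds ht01.1 ht01.2] with v hv
    exact hC.upperTransform_eq_integral_survival hu hv
  exact (hd.congr_of_eventuallyEq he).deriv

theorem integral_decRearrangement_partialTwo_upperTransform (hC : HasCopulaSections C) {u v : ℝ}
    (hu : u ∈ Icc (0 : ℝ) 1) (hv : v ∈ Icc (0 : ℝ) 1) :
    ∫ t in (0 : ℝ)..v, decRearrangement (partialTwo (_root_.upperTransform C) u) t =
      _root_.upperTransform C u v := by
  rw [decRearrangement_congr_ae (hC.partialTwo_upperTransform_ae hu),
    integral_decRearrangement_of_antitone (survival_antitone _)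
      (fun y => (survival_mem_Icc _ y).1) hv, hC.upperTransform_eq_integral_survival hu hv]

theorem zero_left (hC : HasCopulaSections C) {v : ℝ} (hv : v ∈ Icc (0 : ℝ) 1) : C 0 v = 0 := by
  have h0 : (0 : ℝ) ∈ Icc (0 : ℝ) 1 := ⟨le_rfl, zero_le_one⟩
  have h1 : (1 : ℝ) ∈ Icc (0 : ℝ) 1 := ⟨zero_le_one, le_rfl⟩
  have a := hC.mono 0 h0 h0 hv hv.1
  have b := hC.mono 0 h0 hv h1 hv.2
  rw [hC.zero_right 0 h0] at a
  rw [hC.one_right 0 h0] at b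
  exact le_antisymm b a

/-- A `1`-Lipschitz function from `0` to `1` on the unit interval has no slack. -/
theorem one_left (hC : HasCopulaSections C) {v : ℝ} (hv : v ∈ Icc (0 : ℝ) 1) : C 1 v = v := by
  have h0 : (0 : ℝ) ∈ Icc (0 : ℝ) 1 := ⟨le_rfl, zero_le_one⟩
  have h1 : (1 : ℝ) ∈ Icc (0 : ℝ) 1 := ⟨zero_le_one, le_rfl⟩
  have a := (hC.lipschitz 1 h1).dist_le_mul v hv 0 h0
  have b := (hC.lipschitz 1 h1).dist_le_mul 1 h1 v hv
  rw [hC.zero_right 1 h1, Real.dist_eq, Real.dist_eq, sub_zero, sub_zero, abs_of_nonneg hv.1,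
    NNReal.coe_one, one_mul] at a
  rw [hC.one_right 1 h1, Real.dist_eq, Real.dist_eq, abs_of_nonneg (sub_nonneg.2 hv.2),
    NNReal.coe_one, one_mul] at b
  linarith [le_abs_self (C 1 v), le_abs_self (1 - C 1 v)]

/-! ### The two order equivalences and the theorem. -/

theorem lowerOrthantLE_iff (hD : HasCopulaSections D) (hE : HasCopulaSections E) :
    LowerOrthantLE D E ↔ ∀ u ∈ Ioo (0 : ℝ) 1, ∀ v ∈ Icc (0 : ℝ) 1, D u v ≤ E u v := by
  refine ⟨fun h u hu => h u ⟨hu.1.le, hu.2.le⟩, fun h u hu v hv => ?_⟩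
  rcases hu.1.eq_or_lt with rfl | hu0
  · rw [hD.zero_left hv, hE.zero_left hv]
  rcases hu.2.eq_or_lt with rfl | hu1
  · rw [hD.one_left hv, hE.one_left hv]
  exact h u ⟨hu0, hu1⟩ v hv

theorem derivSchurLE_iff_lowerOrthantLE (hD : HasCopulaSections D) (hE : HasCopulaSections E) :
    DerivSchurLE D E ↔ LowerOrthantLE (_root_.upperTransform E) (_root_.upperTransform D) := by
  rw [hE.upperTransform.lowerOrthantLE_iff hD.upperTransform]
  refine forall₂_congr fun u hu => ?_
  have hu' : u ∈ Icc (0 : ℝ) 1 := ⟨hu.1.le, hu.2.le⟩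
  rw [schurLE_iff (hD.isUnitFunction_partialTwo hu') (measurable_partialTwo D u)
    (hE.isUnitFunction_partialTwo hu') (measurable_partialTwo E u)
    (by rw [hD.integral_partialTwo hu', hE.integral_partialTwo hu'])]
  simp only [upperTransform_apply]

theorem derivSchurLE_upperTransform_iff (hD : HasCopulaSections D) (hE : HasCopulaSections E) :
    DerivSchurLE (_root_.upperTransform D) (_root_.upperTransform E) ↔
      LowerOrthantLE (_root_.upperTransform D) (_root_.upperTransform E) := by
  rw [hD.upperTransform.lowerOrthantLE_iff hE.upperTransform]
  refine forall₂_congr fun u hu => ?_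
  have hu' : u ∈ Icc (0 : ℝ) 1 := ⟨hu.1.le, hu.2.le⟩
  have h1 : (1 : ℝ) ∈ Icc (0 : ℝ) 1 := ⟨zero_le_one, le_rfl⟩
  have key : ∀ v ∈ Icc (0 : ℝ) 1, _ := fun v hv =>
    And.intro (hD.integral_decRearrangement_partialTwo_upperTransform hu' hv)
      (hE.integral_decRearrangement_partialTwo_upperTransform hu' hv)
  refine ⟨fun h v hv => ?_, fun h => ⟨fun v hv => ?_, ?_⟩⟩
  · rcases hv.1.eq_or_lt with rfl | hv0
    · rw [hD.upperTransform.zero_right u hu', hE.upperTransform.zero_right u hu']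
    rcases hv.2.eq_or_lt with rfl | hv1
    · rw [hD.upperTransform.one_right u hu', hE.upperTransform.one_right u hu']
    rw [← (key v hv).1, ← (key v hv).2]
    exact h.1 v ⟨hv0, hv1⟩
  · have hv' : v ∈ Icc (0 : ℝ) 1 := ⟨hv.1.le, hv.2.le⟩
    rw [(key v hv').1, (key v hv').2]
    exact h v hv'
  · rw [(key 1 h1).1, (key 1 h1).2, hD.upperTransform.one_right u hu',
      hE.upperTransform.one_right u hu']

end HasCopulaSections

theorem theorem5p1 (D E : ℝ → ℝ → ℝ) (hD : IsCopula D) (hE : IsCopula E) :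
    List.TFAE [
      DerivSchurLE D E,
      LowerOrthantLE (upperTransform E) (upperTransform D),
      DerivSchurLE (upperTransform E) (upperTransform D),
      LowerOrthantLE (upperTransform^[2] D) (upperTransform^[2] E),
      DerivSchurLE (upperTransform^[2] D) (upperTransform^[2] E)] := by
  have hD' := hD.hasCopulaSections
  have hE' := hE.hasCopulaSections
  simp only [Function.iterate_succ, Function.iterate_zero, Function.comp_apply, id_eq]
  tfae_have 1 ↔ 2 := hD'.derivSchurLE_iff_lowerOrthantLE hE'
  tfae_have 3 ↔ 2 := hE'.derivSchurLE_upperTransform_iff hD'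
  -- The duality again, now for the transforms; it reverses the order once more.
  tfae_have 3 ↔ 4 := hE'.upperTransform.derivSchurLE_iff_lowerOrthantLE hD'.upperTransform
  tfae_have 5 ↔ 4 := hD'.upperTransform.derivSchurLE_upperTransform_iff hE'.upperTransform
  tfae_finish
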